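/- Let $\mathbb S^2\subset\mathbb R^3$ be the unit sphere. For a compact set $E\subset\mathbb S^2$ let $\mathcal M(E)$ be the set of Borel probability measures supported on $E$, put $$I(\mu)=\iint\frac{1}{|x-y|}\,d\mu(x)\,d\mu(y),\qquad W(E)=\inf\{I(\mu):\mu\in\mathcal M(E)\},\qquad \operatorname{cap}(E)=\frac1{W(E)},$$ and, when $\operatorname{cap}(E)>0$, let $\mu_E\in\mathcal M(E)$ be the equilibrium measure of $E$, that is, the unique measure in $\mathcal M(E)$ with $I(\mu_E)=W(E)$. For an external field $Q:\mathbb S^2\to[0,\infty]$ the $\mathcal F$-functional is $$\mathcal F(E)=W(E)+\int Q\,d\mu_E .$$ For $0<\alpha<\pi$ let $C_{S,\alpha}$ be the spherical cap centered at the South Pole consisting of the points $(\sin\varphi\cos\theta,\sin\varphi\sin\theta,\cos\varphi)$ with $\alpha\le\varphi\le\pi$, $0\le\theta\le2\pi$. Let $q>0$, $h>0$, $p=(0,0,1)$, and let $$Q(x)=\frac{q}{|x-hp|},\qquad x\in\mathbb S^2,$$ be the external field of a point charge of magnitude $q$ at height $h$ on the positive polar semi-axis (inside, on, or outside the sphere;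 $Q(x)=\infty$ at $x=hp$). **Proposition.** For all $q>0$, $h>0$ and $0<\alpha<\pi$, the cap $C_{S,\alpha}$ has positive capacity and a unique equilibrium measure, and $\mathcal F(C_{S,\alpha})$ is finite, with $$\mathcal F(C_{S,\alpha})=\frac{\pi}{\pi-\alpha+\sin\alpha}\left\{1+\frac{q(h+1)}{2h}\left(1-\frac{\alpha}{\pi}\right)-\frac{q(h-1)}{\pi h}\arctan\left(\cot\left(\frac{\alpha}{2}\right)\frac{h-1}{h+1}\right)\right\}.$$ -/

import Mathlib

open scoped ENNReal
open MeasureTheory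

noncomputable section

/-- Euclidean space `ℝ³`. -/
abbrev E3 : Type := EuclideanSpace ℝ (Fin 3)

/-- The point of the unit sphere with polar angle `φ` (measured from the North Pole) and
azimuth `θ`. -/
def spherePoint (φ θ : ℝ) : E3 :=
  !₂[Real.sin φ * Real.cos θ, Real.sin φ * Real.sin θ, Real.cos φ]

/-- The North Pole `(0, 0, 1)`. -/
def northPole : E3 := !₂[0, 0, 1]

/-- The spherical cap `C_{S,α}` centred at the South Pole: all points of the unit sphere with
polar angle `α ≤ φ ≤ π`. -/
def southCap (α : ℝ) : Set E3 :=
  {x | ∃ φ ∈ Set.Icc α Real.pi, ∃ θ ∈ Set.Icc 0 (2 * Real.pi), x = spherePoint φ θ}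

/-- The unit positive Borel measures supported on the (compact) set `E`. -/
def unitMeasuresOn (E : Set E3) : Set (Measure E3) :=
  {μ | IsProbabilityMeasure μ ∧ μ Eᶜ = 0}

/-- The Newtonian potential `U^μ(x) = ∫ |x - y|⁻¹ dμ(y)`, with `|x - y|⁻¹ = ∞` if `x = y`. -/
def newtonPotential (μ : Measure E3) (x : E3) : ℝ≥0∞ := ∫⁻ y, (edist x y)⁻¹ ∂μ

/-- The Newtonian energy `I(μ) = ∬ |x - y|⁻¹ dμ(x) dμ(y)`. -/
def newtonEnergy (μ : Measure E3) : ℝ≥0∞ := ∫⁻ x, newtonPotential μ x ∂μ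

/-- The Newtonian energy `W(E)` of a set: the infimum of `I(μ)` over the unit measures on `E`
(`∞` if there are none). -/
def minEnergy (E : Set E3) : ℝ≥0∞ := ⨅ μ ∈ unitMeasuresOn E, newtonEnergy μ

/-- The Newtonian capacity `1 / W(E)`. -/
def newtonCapacity (E : Set E3) : ℝ≥0∞ := (minEnergy E)⁻¹

/-- `μ` is a Newtonian equilibrium measure for `E` (with no external field). -/
def IsEquilibriumMeasure (E : Set E3) (μ : Measure E3) : Prop :=
  μ ∈ unitMeasuresOn E ∧ newtonEnergy μ = minEnergy E

open Classical in
/-- The Newtonian equilibrium measure `μ_E` (the zero measure if there is none). -/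
def equilibriumMeasure (E : Set E3) : Measure E3 :=
  if h : ∃ μ, IsEquilibriumMeasure E μ then h.choose else 0

/-- The `𝓕`-functional `𝓕(E) = W(E) + ∫ Q dμ_E` for the external field `Q`. -/
def fFunctional (Q : E3 → ℝ≥0∞) (E : Set E3) : ℝ≥0∞ :=
  minEnergy E + ∫⁻ x, Q x ∂(equilibriumMeasure E)

/-- The field `Q(x) = q / |x - h p|` of a positive charge `q` at height `h` on the polar axis,
`p` being the North Pole; it is `∞` at the charge. -/
def pointChargeField (q h : ℝ) (x : E3) : ℝ≥0∞ :=
  ENNReal.ofReal q / edist x (h • northPole)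

end

/-!
The equilibrium measure of the cap is written down explicitly, and everything is read off from it.

*Positivity.* By subordination, `1 / |x - y|` is a mixture over `s > 0` of the Gaussian kernels
`exp (-s² |x - y|² / 2)`, and by Parseval's identity the energy of `μ - ν` for such a kernel is a
weighted `L²` norm of the difference of characteristic functions. Hence
`2 ∫ U^μ dν ≤ I(μ) + I(ν)`, with equality (when finite) only for `μ = ν`
(`two_mul_lintegral_newtonPotential_le`, `eq_of_two_mul_lintegral_newtonPotential_eq`). It follows
that a unit measure on `E` whose potential equals a constant `w` everywhere on `E` is the unique
equilibrium measure of `E`, with `W(E) = w` (`isEquilibriumMeasure_iff_of_newtonPotential_eq`).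

*Construction.* Stereographic projection from the North Pole maps the cap to the disc of radius
`R = cot (α / 2)` and multiplies the kernel by factors depending on one point each. A measure on
the cap with constant potential therefore corresponds to a density on the disc with potential
proportional to `1 / √(1 + |X|²)` there. In polar coordinates centred at `X`, the planar potential
at `X` is the integral over all directions of the chord integrals through `X`
(`lintegral_inv_sqrt_mul`), and the average of `1 / (1 + |X|² sin²)` is `1 / √(1 + |X|²)`
(`lintegral_div_add_sin_sq`). So a radial density is needed whose integral over the chord at
distance `s` from the centre is proportional to `1 / (1 + s²)`. As the density `1 / √(t² - |Y|²)`
has integral `π` over every chord of its disc, a mixture over `t` provides it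
(`lintegral_capProfile_chord`).

*Evaluation.* Both the total mass and the integral of the field are integrals over the disc of the
radial density against a function `1 / √(d² + k |Y|²)`. Averaging over circles replaces this
function by `d / (d² + k y²)` for a Cartesian coordinate `y`, so these integrals reduce once more to
chord integrals, and to elementary antiderivatives in `arctan`
(`lintegral_capProfile_mul_inv_sqrt`).
-/

/-! ### Strict positivity of the Newtonian energy -/

section Gaussian

variable {V : Type*} [NormedAddCommGroup V] [InnerProductSpace ℝ V] [FiniteDimensional ℝ V]
  [MeasurableSpace V] [BorelSpace V]

variable (V) in
/-- The measure with density `exp (-‖v‖² / 2)`: the standard Gaussian measure, not normalised. -/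
noncomputable def gaussianWeight : Measure V :=
  volume.withDensity fun v => ENNReal.ofReal (Real.exp (-(‖v‖ ^ 2 / 2)))

lemma integrable_exp_neg_norm_sq_half :
    Integrable (fun v : V => Real.exp (-(‖v‖ ^ 2 / 2))) := by
  have h := GaussianFourier.integrable_cexp_neg_mul_sq_norm_add (V := V) (b := 1 / 2)
    (by norm_num) 0 0
  refine h.norm.congr (ae_of_all _ fun v => ?_)
  simp only [zero_mul, add_zero, Complex.norm_exp]
  congr 1
  rw [show -(1 / 2) * (‖v‖ : ℂ) ^ 2 = ((-(‖v‖ ^ 2 / 2) : ℝ) : ℂ) by push_cast; ring,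
    Complex.ofReal_re]

instance : IsFiniteMeasure (gaussianWeight V) :=
  isFiniteMeasure_withDensity_ofReal integrable_exp_neg_norm_sq_half.2

lemma volume_absolutelyContinuous_gaussianWeight :
    (volume : Measure V) ≪ gaussianWeight V :=
  withDensity_absolutelyContinuous' (by fun_prop)
    (ae_of_all _ fun v => by simp [Real.exp_pos])

lemma charFun_gaussianWeight (t : V) :
    charFun (gaussianWeight V) t =
      (((2 * Real.pi) ^ (Module.finrank ℝ V / 2 : ℝ) * Real.exp (-(‖t‖ ^ 2 / 2)) : ℝ) : ℂ) := by
  have h := GaussianFourier.integral_cexp_neg_mul_sq_norm_add (V := V) (b := 1 / 2)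
    (by norm_num) Complex.I t
  rw [charFun_apply, gaussianWeight,
    integral_withDensity_eq_integral_toReal_smul (by fun_prop) (by simp)]
  calc _ = ∫ v : V, Complex.exp (-(1 / 2) * ‖v‖ ^ 2 + Complex.I * inner ℝ t v) := by
        congr 1; ext v
        rw [ENNReal.toReal_ofReal (Real.exp_pos _).le, Complex.real_smul, Complex.ofReal_exp,
          ← Complex.exp_add, real_inner_comm]
        congr 1
        push_cast
        ring
    _ = _ := by
        rw [h]
        push_cast [Complex.ofReal_cpow (by positivity : (0:ℝ) ≤ 2 * Real.pi)]
        congr 1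
        · congr 1; ring
        · congr 1; rw [Complex.I_sq]; ring

/-- Mutual energy of two measures for the Gaussian kernel `exp (-s² ‖x - y‖² / 2)`. -/
noncomputable def gaussEnergy (s : ℝ) (μ ν : Measure V) : ℝ≥0∞ :=
  ∫⁻ x, ∫⁻ y, ENNReal.ofReal (Real.exp (-(‖s • (x - y)‖ ^ 2 / 2))) ∂ν ∂μ

lemma gaussEnergy_eq_ofReal (s : ℝ) (μ ν : Measure V) [IsProbabilityMeasure μ]
    [IsProbabilityMeasure ν] :
    gaussEnergy s μ ν = ENNReal.ofReal
      (∫ p : V × V, Real.exp (-(‖s • (p.1 - p.2)‖ ^ 2 / 2)) ∂(μ.prod ν)) := by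
  have hc : Continuous fun p : V × V => Real.exp (-(‖s • (p.1 - p.2)‖ ^ 2 / 2)) := by fun_prop
  rw [ofReal_integral_eq_lintegral_ofReal _ (ae_of_all _ fun p => (Real.exp_pos _).le),
    lintegral_prod _ (by fun_prop), gaussEnergy]
  refine Integrable.of_bound hc.aestronglyMeasurable 1 (ae_of_all _ fun p => ?_)
  rw [Real.norm_eq_abs, Real.abs_exp, Real.exp_le_one_iff]
  have := sq_nonneg ‖s • (p.1 - p.2)‖
  linarith

/-- Parseval's identity for the Gaussian energy. -/
lemma integral_charFun_mul_conj (s : ℝ) (μ ν : Measure V) [IsProbabilityMeasure μ]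
    [IsProbabilityMeasure ν] :
    ∫ ξ, charFun μ (s • ξ) * (starRingEnd ℂ) (charFun ν (s • ξ)) ∂(gaussianWeight V) =
      (((2 * Real.pi) ^ (Module.finrank ℝ V / 2 : ℝ) *
        ∫ p : V × V, Real.exp (-(‖s • (p.1 - p.2)‖ ^ 2 / 2)) ∂(μ.prod ν) : ℝ) : ℂ) := by
  have h1 : ∀ ξ : V, charFun μ (s • ξ) * (starRingEnd ℂ) (charFun ν (s • ξ)) =
      ∫ p : V × V, Complex.exp (inner ℝ ξ (s • (p.1 - p.2)) * Complex.I) ∂(μ.prod ν) := by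
    intro ξ
    rw [← charFun_neg, charFun_apply, charFun_apply, ← integral_prod_mul]
    congr 1; ext p
    rw [← Complex.exp_add]
    congr 1
    simp only [inner_neg_right, inner_smul_right, inner_sub_right, Complex.ofReal_neg,
      real_inner_comm ξ]
    push_cast
    ring
  have hc : Continuous fun q : V × V × V =>
      Complex.exp (inner ℝ q.1 (s • (q.2.1 - q.2.2)) * Complex.I) := by fun_prop
  simp_rw [h1]
  rw [integral_integral_swap, Complex.ofReal_mul, ← integral_complex_ofReal,
    ← integral_const_mul]
  · congr 1; ext p
    rw [← charFun_apply, charFun_gaussianWeight, Complex.ofReal_mul]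
  · refine Integrable.of_bound hc.aestronglyMeasurable 1 (ae_of_all _ fun q => ?_)
    exact (Complex.norm_exp_ofReal_mul_I _).le

/-- The Gaussian energy of `μ - ν` as a weighted `L²` norm of the difference of the characteristic
functions. -/
lemma integral_norm_sq_charFun_sub (s : ℝ) (μ ν : Measure V) [IsProbabilityMeasure μ]
    [IsProbabilityMeasure ν] :
    ∫ ξ, ‖charFun μ (s • ξ) - charFun ν (s • ξ)‖ ^ 2 ∂(gaussianWeight V) =
      (2 * Real.pi) ^ (Module.finrank ℝ V / 2 : ℝ) *
        ((gaussEnergy s μ μ).toReal + (gaussEnergy s ν ν).toReal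
          - 2 * (gaussEnergy s ν μ).toReal) := by
  have hpos : ∀ (μ ν : Measure V), 0 ≤
      ∫ p : V × V, Real.exp (-(‖s • (p.1 - p.2)‖ ^ 2 / 2)) ∂(μ.prod ν) := fun μ ν =>
    integral_nonneg fun p => (Real.exp_pos _).le
  have hswap : ∫ p : V × V, Real.exp (-(‖s • (p.1 - p.2)‖ ^ 2 / 2)) ∂(μ.prod ν) =
      ∫ p : V × V, Real.exp (-(‖s • (p.1 - p.2)‖ ^ 2 / 2)) ∂(ν.prod μ) := by
    rw [← integral_prod_swap]
    congr 1; ext p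
    rw [Prod.fst_swap, Prod.snd_swap, ← neg_sub, smul_neg, norm_neg]
  have hint : ∀ (μ ν : Measure V) [IsProbabilityMeasure μ] [IsProbabilityMeasure ν],
      Integrable (fun ξ => charFun μ (s • ξ) * (starRingEnd ℂ) (charFun ν (s • ξ)))
        (gaussianWeight V) := by
    intro μ ν _ _
    refine Integrable.of_bound ?_ 1 (ae_of_all _ fun ξ => ?_)
    · have h : ∀ (μ : Measure V) [IsProbabilityMeasure μ],
          StronglyMeasurable fun ξ : V => charFun μ (s • ξ) := fun μ _ =>
        stronglyMeasurable_charFun.comp_measurable (by fun_prop)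
      exact ((h μ).mul (Complex.continuous_conj.comp_stronglyMeasurable (h ν))).aestronglyMeasurable
    · rw [norm_mul, RCLike.norm_conj]
      exact mul_le_one₀ (norm_charFun_le_one _) (norm_nonneg _) (norm_charFun_le_one _)
  simp only [gaussEnergy_eq_ofReal, ENNReal.toReal_ofReal (hpos _ _)]
  apply Complex.ofReal_injective
  rw [← integral_complex_ofReal]
  have hpt : ∀ ξ : V, ((‖charFun μ (s • ξ) - charFun ν (s • ξ)‖ ^ 2 : ℝ) : ℂ) =
      (charFun μ (s • ξ) * (starRingEnd ℂ) (charFun μ (s • ξ)) +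
        charFun ν (s • ξ) * (starRingEnd ℂ) (charFun ν (s • ξ))) -
      (charFun μ (s • ξ) * (starRingEnd ℂ) (charFun ν (s • ξ)) +
        charFun ν (s • ξ) * (starRingEnd ℂ) (charFun μ (s • ξ))) := by
    intro ξ
    push_cast
    rw [← Complex.mul_conj', map_sub]
    ring
  simp_rw [hpt]
  rw [integral_sub ((hint _ _).fun_add (hint _ _)) ((hint _ _).fun_add (hint _ _)),
    integral_add (hint _ _) (hint _ _), integral_add (hint _ _) (hint _ _)]
  simp only [integral_charFun_mul_conj, hswap]
  push_cast
  ring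

lemma gaussEnergy_ne_top (s : ℝ) (μ ν : Measure V) [IsProbabilityMeasure μ]
    [IsProbabilityMeasure ν] : gaussEnergy s μ ν ≠ ∞ := by
  rw [gaussEnergy_eq_ofReal]; exact ENNReal.ofReal_ne_top

lemma two_mul_gaussEnergy_le (s : ℝ) (μ ν : Measure V) [IsProbabilityMeasure μ]
    [IsProbabilityMeasure ν] :
    2 * gaussEnergy s ν μ ≤ gaussEnergy s μ μ + gaussEnergy s ν ν := by
  have h := integral_norm_sq_charFun_sub s μ ν
  have h0 : 0 ≤ ∫ ξ, ‖charFun μ (s • ξ) - charFun ν (s • ξ)‖ ^ 2 ∂(gaussianWeight V) :=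
    integral_nonneg fun ξ => by positivity
  rw [h] at h0
  have h1 := nonneg_of_mul_nonneg_right h0 (by positivity)
  rw [← ENNReal.toReal_le_toReal (ENNReal.mul_ne_top (by simp) (gaussEnergy_ne_top _ _ _))
    (ENNReal.add_ne_top.2 ⟨gaussEnergy_ne_top _ _ _, gaussEnergy_ne_top _ _ _⟩),
    ENNReal.toReal_add (gaussEnergy_ne_top _ _ _) (gaussEnergy_ne_top _ _ _), ENNReal.toReal_mul]
  simp only [ENNReal.toReal_ofNat]
  linarith

lemma eq_of_two_mul_gaussEnergy_eq {s : ℝ} (hs : s ≠ 0) {μ ν : Measure V}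
    [IsProbabilityMeasure μ] [IsProbabilityMeasure ν]
    (h : 2 * gaussEnergy s ν μ = gaussEnergy s μ μ + gaussEnergy s ν ν) : μ = ν := by
  have h0 := integral_norm_sq_charFun_sub s μ ν
  have h1 := congrArg ENNReal.toReal h
  rw [ENNReal.toReal_add (gaussEnergy_ne_top _ _ _) (gaussEnergy_ne_top _ _ _), ENNReal.toReal_mul,
    ENNReal.toReal_ofNat] at h1
  rw [h1, sub_self, mul_zero] at h0
  have hcont : ∀ (μ : Measure V) [IsProbabilityMeasure μ],
      Continuous fun ξ : V => charFun μ (s • ξ) := fun μ _ =>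
    continuous_charFun.comp (continuous_const_smul s)
  have hint : Integrable (fun ξ => ‖charFun μ (s • ξ) - charFun ν (s • ξ)‖ ^ 2)
      (gaussianWeight V) := by
    refine Integrable.of_bound (((hcont μ).sub (hcont ν)).norm.pow 2).aestronglyMeasurable 4
      (ae_of_all _ fun ξ => ?_)
    have := norm_sub_le_of_le (norm_charFun_le_one (μ := μ) (s • ξ))
      (norm_charFun_le_one (μ := ν) (s • ξ))
    rw [norm_pow, norm_norm]
    nlinarith [norm_nonneg (charFun μ (s • ξ) - charFun ν (s • ξ))]
  rw [integral_eq_zero_iff_of_nonneg (fun ξ => by positivity) hint] at h0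
  have h2 : (fun ξ => charFun μ (s • ξ)) =ᵐ[volume] fun ξ => charFun ν (s • ξ) := by
    filter_upwards [volume_absolutelyContinuous_gaussianWeight.ae_le h0] with ξ hξ
    simpa [sub_eq_zero] using hξ
  -- Continuous functions that agree almost everywhere agree everywhere.
  have h3 := ((hcont μ).ae_eq_iff_eq volume (hcont ν)).1 h2
  refine Measure.ext_of_charFun (funext fun t => ?_)
  simpa [smul_smul, hs] using congrFun h3 (s⁻¹ • t)

end Gaussian

/-- Subordination: the Newtonian kernel is a mixture of Gaussian kernels. -/
lemma inv_edist_eq_lintegral_exp {V : Type*} [NormedAddCommGroup V] [NormedSpace ℝ V] (x y : V) :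
    (edist x y)⁻¹ = ENNReal.ofReal (√(2 / Real.pi)) *
      ∫⁻ s in Set.Ioi (0 : ℝ), ENNReal.ofReal (Real.exp (-(‖s • (x - y)‖ ^ 2 / 2))) := by
  have hπ := Real.pi_pos
  rcases eq_or_ne x y with rfl | hxy
  · simp [hπ, ENNReal.mul_top]
  have hd : 0 < ‖x - y‖ := norm_pos_iff.2 (sub_ne_zero.2 hxy)
  set d := ‖x - y‖ with hdd
  have hfun : (fun s : ℝ => Real.exp (-(‖s • (x - y)‖ ^ 2 / 2))) =
      fun s => Real.exp (-(d ^ 2 / 2) * s ^ 2) := by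
    ext s
    rw [norm_smul, mul_pow, Real.norm_eq_abs, sq_abs, ← hdd]
    congr 1; ring
  have hi := integrable_exp_neg_mul_sq (b := d ^ 2 / 2) (by positivity)
  have key : ∫⁻ s in Set.Ioi (0 : ℝ), ENNReal.ofReal (Real.exp (-(‖s • (x - y)‖ ^ 2 / 2))) =
      ENNReal.ofReal (√(Real.pi / (d ^ 2 / 2)) / 2) := by
    simp_rw [fun s : ℝ => congrFun hfun s]
    rw [← integral_gaussian_Ioi, ofReal_integral_eq_lintegral_ofReal hi.integrableOn
      (ae_of_all _ fun s => (Real.exp_pos _).le)]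
  rw [key, ← ENNReal.ofReal_mul (by positivity), edist_dist, dist_eq_norm, ← hdd,
    ← ENNReal.ofReal_inv_of_pos hd]
  congr 1
  rw [← mul_div_assoc, ← Real.sqrt_mul (by positivity)]
  have : 2 / Real.pi * (Real.pi / (d ^ 2 / 2)) = (2 / d) ^ 2 := by field_simp
  rw [this, Real.sqrt_sq (by positivity)]
  field_simp

lemma measurable_gaussEnergy (μ ν : Measure E3) [SFinite μ] [SFinite ν] :
    Measurable fun s => gaussEnergy s μ ν := by
  unfold gaussEnergy
  refine Measurable.lintegral_prod_right' (f := fun q : ℝ × E3 =>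
    ∫⁻ y, ENNReal.ofReal (Real.exp (-(‖q.1 • (q.2 - y)‖ ^ 2 / 2))) ∂ν) ?_
  exact Measurable.lintegral_prod_right' (f := fun p : (ℝ × E3) × E3 =>
    ENNReal.ofReal (Real.exp (-(‖p.1.1 • (p.1.2 - p.2)‖ ^ 2 / 2)))) (by fun_prop)

lemma lintegral_newtonPotential (μ ν : Measure E3) [SFinite μ] [SFinite ν] :
    ∫⁻ x, newtonPotential μ x ∂ν = ENNReal.ofReal (√(2 / Real.pi)) *
      ∫⁻ s in Set.Ioi (0 : ℝ), gaussEnergy s ν μ := by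
  simp_rw [newtonPotential, inv_edist_eq_lintegral_exp]
  have h1 : ∀ x : E3, ∫⁻ y, (ENNReal.ofReal (√(2 / Real.pi)) *
      ∫⁻ s in Set.Ioi (0 : ℝ), ENNReal.ofReal (Real.exp (-(‖s • (x - y)‖ ^ 2 / 2)))) ∂μ =
      ENNReal.ofReal (√(2 / Real.pi)) * ∫⁻ s in Set.Ioi (0 : ℝ),
        ∫⁻ y, ENNReal.ofReal (Real.exp (-(‖s • (x - y)‖ ^ 2 / 2))) ∂μ := by
    intro x
    rw [lintegral_const_mul' _ _ ENNReal.ofReal_ne_top, lintegral_lintegral_swap]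
    exact Measurable.aemeasurable (by fun_prop)
  simp_rw [h1]
  rw [lintegral_const_mul' _ _ ENNReal.ofReal_ne_top, lintegral_lintegral_swap]
  · rfl
  · refine Measurable.aemeasurable ?_
    exact Measurable.lintegral_prod_right' (f := fun p : (E3 × ℝ) × E3 =>
      ENNReal.ofReal (Real.exp (-(‖p.1.2 • (p.1.1 - p.2)‖ ^ 2 / 2)))) (by fun_prop)

/-- The Newtonian energy of the difference of two probability measures is nonnegative. -/
lemma two_mul_lintegral_newtonPotential_le (μ ν : Measure E3) [IsProbabilityMeasure μ]
    [IsProbabilityMeasure ν] :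
    2 * ∫⁻ x, newtonPotential μ x ∂ν ≤ newtonEnergy μ + newtonEnergy ν := by
  simp only [newtonEnergy, lintegral_newtonPotential]
  rw [← mul_add, mul_left_comm, ← lintegral_add_left (measurable_gaussEnergy _ _),
    ← lintegral_const_mul _ (measurable_gaussEnergy _ _)]
  gcongr
  exact two_mul_gaussEnergy_le _ _ _

/-- The Newtonian energy of the difference of two probability measures vanishes only if they
coincide. -/
lemma eq_of_two_mul_lintegral_newtonPotential_eq {μ ν : Measure E3} [IsProbabilityMeasure μ]
    [IsProbabilityMeasure ν] (hfin : ∫⁻ x, newtonPotential μ x ∂ν ≠ ∞)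
    (h : 2 * ∫⁻ x, newtonPotential μ x ∂ν = newtonEnergy μ + newtonEnergy ν) : μ = ν := by
  have hc0 : ENNReal.ofReal (√(2 / Real.pi)) ≠ 0 := by
    have := Real.pi_pos
    simp [this]
  simp only [newtonEnergy, lintegral_newtonPotential] at h hfin
  rw [← mul_add, mul_left_comm, ← lintegral_add_left (measurable_gaussEnergy _ _),
    ← lintegral_const_mul _ (measurable_gaussEnergy _ _),
    ENNReal.mul_right_inj hc0 ENNReal.ofReal_ne_top] at h
  have hfin2 : ∫⁻ s in Set.Ioi (0 : ℝ), 2 * gaussEnergy s ν μ ≠ ∞ := by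
    rw [lintegral_const_mul _ (measurable_gaussEnergy _ _)]
    refine ENNReal.mul_ne_top (by simp) fun htop => hfin ?_
    rw [htop, ENNReal.mul_top hc0]
  have hae := ae_eq_of_ae_le_of_lintegral_le (ae_of_all _ fun s => two_mul_gaussEnergy_le s μ ν)
    hfin2 ((measurable_gaussEnergy μ μ).add (measurable_gaussEnergy ν ν)).aemeasurable h.ge
  have hvol : (volume.restrict (Set.Ioi (0 : ℝ))) ≠ 0 := by
    rw [Ne, Measure.restrict_eq_zero]; simp
  have : (ae (volume.restrict (Set.Ioi (0 : ℝ)))).NeBot := ae_neBot.2 hvol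
  obtain ⟨s, hs, hs0⟩ := (hae.and (ae_restrict_mem measurableSet_Ioi)).exists
  exact eq_of_two_mul_gaussEnergy_eq (ne_of_gt hs0) hs

/-! ### Elementary integrals -/

/-- The fundamental theorem of calculus for the Lebesgue integral of a nonnegative derivative,
which may be unbounded near the endpoints. -/
lemma lintegral_Ioo_of_hasDerivAt {a b : ℝ} (hab : a ≤ b) {f f' : ℝ → ℝ}
    (hc : ContinuousOn f (Set.Icc a b)) (hd : ∀ x ∈ Set.Ioo a b, HasDerivAt f (f' x) x)
    (hpos : ∀ x ∈ Set.Ioo a b, 0 ≤ f' x) :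
    ∫⁻ x in Set.Ioo a b, ENNReal.ofReal (f' x) = ENNReal.ofReal (f b - f a) := by
  have hint : IntegrableOn f' (Set.Ioc a b) :=
    intervalIntegral.integrableOn_deriv_of_nonneg hc hd hpos
  have h := intervalIntegral.integral_eq_sub_of_hasDerivAt_of_le hab hc hd
    ((intervalIntegrable_iff_integrableOn_Ioc_of_le hab).2 hint)
  rw [intervalIntegral.integral_of_le hab, integral_Ioc_eq_integral_Ioo] at h
  rw [← h, ofReal_integral_eq_lintegral_ofReal (hint.mono_set Set.Ioo_subset_Ioc_self)]
  exact (ae_restrict_iff' measurableSet_Ioo).2 (ae_of_all _ hpos)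

lemma lintegral_inv_sqrt_sub_sq (A : ℝ) :
    ∫⁻ u : ℝ, ENNReal.ofReal ((√(A - u ^ 2))⁻¹) =
      if 0 < A then ENNReal.ofReal Real.pi else 0 := by
  split_ifs with hA
  · set a := √A with ha
    have ha0 : 0 < a := Real.sqrt_pos.2 hA
    have haA : a ^ 2 = A := Real.sq_sqrt hA.le
    have hlt : ∀ u ∈ Set.Ioo (-a) a, u ^ 2 < a ^ 2 := fun u hu => sq_lt_sq' hu.1 hu.2
    have h1 : ∫⁻ u in Set.Ioo (-a) a, ENNReal.ofReal ((√(A - u ^ 2))⁻¹) =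
        ENNReal.ofReal Real.pi := by
      rw [lintegral_Ioo_of_hasDerivAt (f := fun u => Real.arcsin (u / a)) (by linarith)
        (by fun_prop)]
      · rw [div_self ha0.ne', neg_div, div_self ha0.ne', Real.arcsin_one, Real.arcsin_neg_one]
        congr 1; ring
      · intro u hu
        have hu2 := hlt u hu
        have hd : 0 < A - u ^ 2 := by linarith
        have hne1 : u / a ≠ -1 := by
          rw [Ne, div_eq_iff ha0.ne']; linarith [hu.1]
        have hne2 : u / a ≠ 1 := by
          rw [Ne, div_eq_iff ha0.ne']; linarith [hu.2]
        convert! (Real.hasDerivAt_arcsin hne1 hne2).comp u ((hasDerivAt_id u).div_const a) using 1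
        have : 1 - (u / a) ^ 2 = (A - u ^ 2) / a ^ 2 := by field_simp; rw [haA]
        rw [this, Real.sqrt_div hd.le, Real.sqrt_sq ha0.le]
        have := Real.sqrt_pos.2 hd
        field_simp
      · intro u _; positivity
    rw [← h1, ← lintegral_indicator measurableSet_Ioo]
    congr 1; ext u
    by_cases hu : u ∈ Set.Ioo (-a) a
    · rw [Set.indicator_of_mem hu]
    · rw [Set.indicator_of_notMem hu, Real.sqrt_eq_zero_of_nonpos, inv_zero, ENNReal.ofReal_zero]
      by_contra! h
      exact hu (Set.mem_Ioo.2 (abs_lt.1 (abs_lt_of_sq_lt_sq (by linarith) ha0.le)))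
  · have : ∀ u : ℝ, ENNReal.ofReal ((√(A - u ^ 2))⁻¹) = 0 := fun u => by
      rw [Real.sqrt_eq_zero_of_nonpos (by nlinarith [sq_nonneg u]), inv_zero, ENNReal.ofReal_zero]
    simp [this]

/-- The average of `d / (d² + k sin²)` over any number of half-turns is `1 / √(d² + k)`. The antiderivative is
the branch of `arctan (√(d² + k) tan θ / d) / √(d² + k)` that is smooth on the whole line. -/
lemma lintegral_div_add_sin_sq {d k : ℝ} (hd : 0 < d) (hk : 0 ≤ k) (a ω : ℝ) (n : ℕ) :
    ∫⁻ θ in Set.Ioo a (a + n * Real.pi),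
      ENNReal.ofReal (d / (d ^ 2 + k * Real.sin (θ - ω) ^ 2)) =
      ENNReal.ofReal (n * Real.pi / √(d ^ 2 + k)) := by
  set b := √(d ^ 2 + k) with hb
  have hb0 : 0 < b := Real.sqrt_pos.2 (by positivity)
  have hb2 : b ^ 2 = d ^ 2 + k := Real.sq_sqrt (by positivity)
  set N : ℝ → ℝ := fun θ => (b - d) * (Real.sin (θ - ω) * Real.cos (θ - ω)) with hN
  set D : ℝ → ℝ := fun θ => d * Real.cos (θ - ω) ^ 2 + b * Real.sin (θ - ω) ^ 2 with hD
  have hDpos : ∀ θ, 0 < D θ := fun θ => by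
    rcases eq_or_ne (Real.cos (θ - ω)) 0 with h | h
    · have : Real.sin (θ - ω) ^ 2 = 1 := by
        have := Real.sin_sq_add_cos_sq (θ - ω); rw [h] at this; linarith
      simp only [hD, h, this]; linarith
    · simp only [hD]; positivity
  have hder : ∀ θ, HasDerivAt (fun θ => (θ + Real.arctan (N θ / D θ)) / b)
      (d / (d ^ 2 + k * Real.sin (θ - ω) ^ 2)) θ := by
    intro θ
    have hs : HasDerivAt (fun θ => Real.sin (θ - ω)) (Real.cos (θ - ω)) θ := by
      simpa using ((hasDerivAt_id θ).sub_const ω).sin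
    have hc : HasDerivAt (fun θ => Real.cos (θ - ω)) (-Real.sin (θ - ω)) θ := by
      simpa using ((hasDerivAt_id θ).sub_const ω).cos
    have hN' := (hs.mul hc).const_mul (b - d)
    have hD' := ((hc.pow 2).const_mul d).add ((hs.pow 2).const_mul b)
    have h := ((hasDerivAt_id θ).add ((hN'.div hD' (hDpos θ).ne').arctan)).div_const b
    convert! h using 1
    have hDθ := hDpos θ
    have hsc := Real.sin_sq_add_cos_sq (θ - ω)
    simp only [hD] at hDθ
    simp only [Pi.mul_apply, Pi.add_apply, Pi.pow_apply, Pi.div_apply]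
    generalize Real.sin (θ - ω) = s at *
    generalize Real.cos (θ - ω) = c at *
    have hk' : k = b ^ 2 - d ^ 2 := by linarith
    have hQ : d ^ 2 + k * s ^ 2 = d ^ 2 * c ^ 2 + b ^ 2 * s ^ 2 := by
      rw [hk']; linear_combination (-d ^ 2) * hsc
    have hQpos : 0 < d ^ 2 + k * s ^ 2 := by positivity
    have hDN : (d * c ^ 2 + b * s ^ 2) ^ 2 + ((b - d) * (s * c)) ^ 2 =
        d ^ 2 + k * s ^ 2 := by
      rw [hQ]; linear_combination (d ^ 2 * c ^ 2 + b ^ 2 * s ^ 2) * hsc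
    have h1 : 1 + ((b - d) * (s * c) / (d * c ^ 2 + b * s ^ 2)) ^ 2 =
        (d ^ 2 + k * s ^ 2) / (d * c ^ 2 + b * s ^ 2) ^ 2 := by
      rw [← hDN]; field_simp
    have hnum : (b - d) * (c * c + s * -s) * (d * c ^ 2 + b * s ^ 2) - (b - d) * (s * c) *
        (d * (((2 : ℕ) : ℝ) * c ^ (2 - 1) * -s) + b * (((2 : ℕ) : ℝ) * s ^ (2 - 1) * c)) =
        b * d - (d ^ 2 + k * s ^ 2) := by
      rw [hk']
      push_cast
      linear_combination ((b - d) * (d * c ^ 2 - b * s ^ 2) + (b - d) * d) * hsc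
    rw [h1, hnum]
    have hQ0 := hQpos.ne'
    generalize d * c ^ 2 + b * s ^ 2 = E at hDθ ⊢
    generalize d ^ 2 + k * s ^ 2 = Q at hQ0 ⊢
    field_simp
    ring
  rw [lintegral_Ioo_of_hasDerivAt (by have := Real.pi_pos; nlinarith [n.cast_nonneg (α := ℝ)])
    (fun θ _ => (hder θ).continuousAt.continuousWithinAt) (fun θ _ => hder θ)
    (fun θ _ => by positivity)]
  have hper : N (a + n * Real.pi) / D (a + n * Real.pi) = N a / D a := by
    have h1 : a + n * Real.pi - ω = a - ω + n * Real.pi := by ring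
    have h2 : ((-1 : ℝ) ^ n) ^ 2 = 1 := by rw [← pow_mul, mul_comm, pow_mul]; simp
    simp only [hN, hD, h1, Real.sin_add_nat_mul_pi, Real.cos_add_nat_mul_pi, mul_pow, h2]
    congr 1
    · linear_combination ((b - d) * (Real.sin (a - ω) * Real.cos (a - ω))) * h2
    · ring
  rw [hper]
  congr 1
  ring

/-! ### Polar coordinates in the plane -/

lemma setLIntegral_polarCoord_target (f : ℝ × ℝ → ℝ≥0∞) (hf : Measurable f) :
    ∫⁻ p in polarCoord.target, f p =
      ∫⁻ θ in Set.Ioo (-Real.pi) Real.pi, ∫⁻ r in Set.Ioi (0 : ℝ), f (r, θ) := by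
  rw [polarCoord_target, Measure.volume_eq_prod, ← Measure.prod_restrict,
    lintegral_prod_symm _ hf.aemeasurable]

/-- Integration against `1 / |Z|` in the plane is integration over all lines through the origin. -/
lemma lintegral_inv_sqrt_mul (f : ℝ × ℝ → ℝ≥0∞) (hf : Measurable f) :
    ∫⁻ Z : ℝ × ℝ, ENNReal.ofReal ((√(Z.1 ^ 2 + Z.2 ^ 2))⁻¹) * f Z =
      ∫⁻ θ in Set.Ioo 0 Real.pi, ∫⁻ r : ℝ, f (r * Real.cos θ, r * Real.sin θ) := by
  set F : ℝ → ℝ≥0∞ := fun θ => ∫⁻ r in Set.Ioi (0 : ℝ), f (r * Real.cos θ, r * Real.sin θ) with hF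
  have hFm : Measurable F := by
    refine Measurable.lintegral_prod_right' (f := fun q : ℝ × ℝ =>
      f (q.2 * Real.cos q.1, q.2 * Real.sin q.1)) (hf.comp (by fun_prop))
  have hpolar : ∫⁻ Z : ℝ × ℝ, ENNReal.ofReal ((√(Z.1 ^ 2 + Z.2 ^ 2))⁻¹) * f Z =
      ∫⁻ θ in Set.Ioo (-Real.pi) Real.pi, F θ := by
    rw [← lintegral_comp_polarCoord_symm]
    have h : ∀ p ∈ polarCoord.target, ENNReal.ofReal p.1 •
        (ENNReal.ofReal ((√((polarCoord.symm p).1 ^ 2 + (polarCoord.symm p).2 ^ 2))⁻¹) *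
          f (polarCoord.symm p)) = f (p.1 * Real.cos p.2, p.1 * Real.sin p.2) := by
      intro p hp
      have hp0 : 0 < p.1 := hp.1
      have h2 : (p.1 * Real.cos p.2) ^ 2 + (p.1 * Real.sin p.2) ^ 2 = p.1 ^ 2 := by
        linear_combination p.1 ^ 2 * Real.sin_sq_add_cos_sq p.2
      rw [polarCoord_symm_apply, h2, Real.sqrt_sq hp0.le, smul_eq_mul, ← mul_assoc,
        ← ENNReal.ofReal_mul hp0.le, mul_inv_cancel₀ hp0.ne', ENNReal.ofReal_one, one_mul]
    rw [setLIntegral_congr_fun polarCoord.open_target.measurableSet h,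
      setLIntegral_polarCoord_target
        (fun p => f (p.1 * Real.cos p.2, p.1 * Real.sin p.2)) (hf.comp (by fun_prop))]
  -- Rays in directions `θ - π` and `θ` together form a line.
  have hneg : ∫⁻ θ in Set.Ioo (-Real.pi) 0, F θ = ∫⁻ θ in Set.Ioo 0 Real.pi, F (θ - Real.pi) := by
    rw [← lintegral_indicator measurableSet_Ioo, ← lintegral_indicator measurableSet_Ioo,
      ← lintegral_sub_right_eq_self _ Real.pi]
    congr 1; ext θ
    simp only [Set.indicator_apply, Set.mem_Ioo]
    congr 1
    apply propext
    constructor <;> rintro ⟨h1, h2⟩ <;> constructor <;> linarith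
  have hline : ∀ θ, F (θ - Real.pi) + F θ = ∫⁻ r : ℝ, f (r * Real.cos θ, r * Real.sin θ) := by
    intro θ
    have h1 : F (θ - Real.pi) = ∫⁻ r in Set.Iio (0 : ℝ), f (r * Real.cos θ, r * Real.sin θ) := by
      rw [← lintegral_indicator measurableSet_Iio, ← lintegral_neg_eq_self, hF]
      simp only
      rw [← lintegral_indicator measurableSet_Ioi]
      congr 1; ext r
      simp only [Set.indicator_apply, Set.mem_Ioi, Set.mem_Iio, Left.neg_neg_iff,
        Real.cos_sub_pi, Real.sin_sub_pi, mul_neg, neg_mul]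
    rw [h1, hF, ← lintegral_add_compl (μ := volume) (fun r : ℝ => f (r * Real.cos θ, r * Real.sin θ))
      (measurableSet_Iio (a := (0 : ℝ))), Set.compl_Iio]
    congr 1
    exact setLIntegral_congr (Ioi_ae_eq_Ici (μ := volume) (a := (0 : ℝ)))
  have hsplit : ∫⁻ θ in Set.Ioo (-Real.pi) Real.pi, F θ =
      (∫⁻ θ in Set.Ioo (-Real.pi) 0, F θ) + ∫⁻ θ in Set.Ioo 0 Real.pi, F θ := by
    have hπ := Real.pi_pos
    rw [← Set.Ioo_union_Ico_eq_Ioo (b := 0) (by linarith) hπ.le,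
      lintegral_union measurableSet_Ico
        (Set.disjoint_left.2 fun x hx hx' => absurd hx.2 (not_lt.2 hx'.1))]
    congr 1
    exact setLIntegral_congr Ioo_ae_eq_Ico.symm
  rw [hpolar, hsplit, hneg, ← lintegral_add_right _ hFm]
  simp_rw [hline]

/-- For a radial weight, `1 / √(d² + k |Y|²)` may be replaced by `d / (d² + k y²)`, where `y` is
one Cartesian coordinate: both have the same average over each circle about the origin. -/
lemma lintegral_radial_mul_inv_sqrt {d k : ℝ} (hd : 0 < d) (hk : 0 ≤ k) (f : ℝ → ℝ≥0∞)
    (hf : Measurable f) :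
    ∫⁻ Y : ℝ × ℝ, f (Y.1 ^ 2 + Y.2 ^ 2) *
        ENNReal.ofReal ((√(d ^ 2 + k * (Y.1 ^ 2 + Y.2 ^ 2)))⁻¹) =
      ∫⁻ Y : ℝ × ℝ, f (Y.1 ^ 2 + Y.2 ^ 2) * ENNReal.ofReal (d / (d ^ 2 + k * Y.2 ^ 2)) := by
  have hsq : ∀ r θ : ℝ, (r * Real.cos θ) ^ 2 + (r * Real.sin θ) ^ 2 = r ^ 2 := fun r θ => by
    linear_combination r ^ 2 * Real.sin_sq_add_cos_sq θ
  have hang : ∀ r : ℝ, ∫⁻ θ in Set.Ioo (-Real.pi) Real.pi,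
      ENNReal.ofReal (d / (d ^ 2 + k * (r * Real.sin θ) ^ 2)) =
      ∫⁻ _θ in Set.Ioo (-Real.pi) Real.pi, ENNReal.ofReal ((√(d ^ 2 + k * r ^ 2))⁻¹) := by
    intro r
    have h := lintegral_div_add_sin_sq hd (mul_nonneg hk (sq_nonneg r)) (-Real.pi) 0 2
    have h2 : -Real.pi + ((2 : ℕ) : ℝ) * Real.pi = Real.pi := by push_cast; ring
    rw [h2] at h
    simp only [sub_zero] at h
    simp only [mul_pow, ← mul_assoc]
    rw [h, setLIntegral_const, Real.volume_Ioo, ← ENNReal.ofReal_mul (by positivity)]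
    congr 1
    push_cast
    ring
  rw [← lintegral_comp_polarCoord_symm, ← lintegral_comp_polarCoord_symm]
  simp only [polarCoord_symm_apply, hsq, smul_eq_mul]
  rw [polarCoord_target, Measure.volume_eq_prod, ← Measure.prod_restrict,
    lintegral_prod _ (Measurable.aemeasurable (by fun_prop)),
    lintegral_prod _ (Measurable.aemeasurable (by fun_prop))]
  congr 1; ext r
  simp only [← mul_assoc]
  rw [lintegral_const_mul _ (by fun_prop), lintegral_const_mul _ (by fun_prop), hang]

/-! ### The radial profile and its chord integrals -/

/-- The radial density on the disc of radius `R`, as a function of `w = |Y|²`. It is a mixture of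
the equilibrium densities `1 / √(t² - w)` of the concentric discs of radius
`t = min R √(1 / v - 1)`, with `v` uniform on `(0, 1)`. The junk values `√x = 0` for `x < 0` and
`0⁻¹ = 0` make each of these densities vanish outside its disc. -/
noncomputable def capProfile (R w : ℝ) : ℝ≥0∞ :=
  ∫⁻ v in Set.Ioo (0 : ℝ) 1, ENNReal.ofReal ((√(min (R ^ 2) (1 / v - 1) - w))⁻¹)

lemma measurable_capProfile (R : ℝ) : Measurable (capProfile R) := by
  unfold capProfile
  exact Measurable.lintegral_prod_right' (f := fun p : ℝ × ℝ =>
    ENNReal.ofReal ((√(min (R ^ 2) (1 / p.2 - 1) - p.1))⁻¹)) (by fun_prop)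

lemma capProfile_eq_zero {R w : ℝ} (h : R ^ 2 ≤ w) : capProfile R w = 0 := by
  have : ∀ v : ℝ, ENNReal.ofReal ((√(min (R ^ 2) (1 / v - 1) - w))⁻¹) = 0 := fun v => by
    rw [Real.sqrt_eq_zero_of_nonpos (by linarith [min_le_left (R ^ 2) (1 / v - 1)]), inv_zero,
      ENNReal.ofReal_zero]
  simp only [capProfile, this, lintegral_zero]

/-- The integral of the profile along the chord at distance `|s|` from the centre. -/
lemma lintegral_capProfile_chord (R s : ℝ) :
    ∫⁻ u : ℝ, capProfile R (s ^ 2 + u ^ 2) =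
      if s ^ 2 < R ^ 2 then ENNReal.ofReal (Real.pi / (1 + s ^ 2)) else 0 := by
  split_ifs with hs
  · unfold capProfile
    rw [lintegral_lintegral_swap (Measurable.aemeasurable (by fun_prop))]
    simp_rw [← sub_sub, lintegral_inv_sqrt_sub_sq]
    -- The discs that the chord meets are those with `v < 1 / (1 + s²)`.
    have hset : Set.Ioo (0 : ℝ) 1 ∩ {v | 0 < min (R ^ 2) (1 / v - 1) - s ^ 2} =
        Set.Ioo 0 (1 / (1 + s ^ 2)) := by
      ext v
      simp only [Set.mem_inter_iff, Set.mem_Ioo, Set.mem_ofPred_eq, sub_pos, lt_min_iff]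
      have hs0 : 0 < 1 + s ^ 2 := by positivity
      constructor
      · rintro ⟨⟨h0, -⟩, -, h2⟩
        refine ⟨h0, ?_⟩
        rw [lt_div_comm₀ h0 hs0]; linarith
      · rintro ⟨h0, h1⟩
        refine ⟨⟨h0, h1.trans_le ?_⟩, hs, ?_⟩
        · rw [div_le_one hs0]; nlinarith [sq_nonneg s]
        · rw [lt_div_comm₀ h0 hs0] at h1; linarith
    have hm : MeasurableSet {v : ℝ | 0 < min (R ^ 2) (1 / v - 1) - s ^ 2} :=
      measurableSet_lt (by fun_prop) (by fun_prop)
    have hind : ∀ v : ℝ, (if 0 < min (R ^ 2) (1 / v - 1) - s ^ 2 then ENNReal.ofReal Real.pi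
        else 0) = {v : ℝ | 0 < min (R ^ 2) (1 / v - 1) - s ^ 2}.indicator
          (fun _ => ENNReal.ofReal Real.pi) v := fun v => by
      simp [Set.indicator_apply]
    simp_rw [hind]
    rw [lintegral_indicator hm, setLIntegral_const, Measure.restrict_apply hm, Set.inter_comm,
      hset, Real.volume_Ioo, ← ENNReal.ofReal_mul Real.pi_pos.le]
    congr 1
    ring
  · have h0 : ∀ u : ℝ, capProfile R (s ^ 2 + u ^ 2) = 0 := fun u =>
      capProfile_eq_zero (by linarith [sq_nonneg u])
    simp only [h0, lintegral_zero]

lemma lintegral_capProfile_mul_inv_sqrt {R d k : ℝ} (hR : 0 < R) (hd : 0 < d) (hk : 0 ≤ k) :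
    ∫⁻ Y : ℝ × ℝ, capProfile R (Y.1 ^ 2 + Y.2 ^ 2) *
        ENNReal.ofReal ((√(d ^ 2 + k * (Y.1 ^ 2 + Y.2 ^ 2)))⁻¹) =
      ∫⁻ s in Set.Ioo (-R) R,
        ENNReal.ofReal (Real.pi / (1 + s ^ 2) * (d / (d ^ 2 + k * s ^ 2))) := by
  have hm := measurable_capProfile R
  rw [lintegral_radial_mul_inv_sqrt hd hk _ hm, Measure.volume_eq_prod,
    lintegral_prod_symm _ (Measurable.aemeasurable (by fun_prop)),
    ← lintegral_indicator measurableSet_Ioo]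
  congr 1; ext s
  simp only
  rw [lintegral_mul_const _ (by fun_prop)]
  simp_rw [add_comm _ (s ^ 2), lintegral_capProfile_chord]
  have hiff : s ∈ Set.Ioo (-R) R ↔ s ^ 2 < R ^ 2 := by
    rw [Set.mem_Ioo, ← abs_lt, sq_lt_sq, abs_of_pos hR]
  by_cases h : s ^ 2 < R ^ 2
  · rw [if_pos h, Set.indicator_of_mem (hiff.2 h), ENNReal.ofReal_mul (by positivity)]
  · rw [if_neg h, Set.indicator_of_notMem (fun h' => h (hiff.1 h')), zero_mul]

/-- In the closed disc of radius `R`, the planar Newtonian potential of the profile is that of a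
point charge at height `1` above the centre. -/
lemma lintegral_inv_sqrt_mul_capProfile {R ρ : ℝ} (hR : 0 < R) (hρ : 0 ≤ ρ) (hρR : ρ ≤ R)
    (ω : ℝ) :
    ∫⁻ Y : ℝ × ℝ, ENNReal.ofReal
        ((√((Y.1 - ρ * Real.cos ω) ^ 2 + (Y.2 - ρ * Real.sin ω) ^ 2))⁻¹) *
          capProfile R (Y.1 ^ 2 + Y.2 ^ 2) =
      ENNReal.ofReal (Real.pi ^ 2 / √(1 + ρ ^ 2)) := by
  have hm := measurable_capProfile R
  have hshift : ∫⁻ Y : ℝ × ℝ, ENNReal.ofReal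
        ((√((Y.1 - ρ * Real.cos ω) ^ 2 + (Y.2 - ρ * Real.sin ω) ^ 2))⁻¹) *
          capProfile R (Y.1 ^ 2 + Y.2 ^ 2) =
      ∫⁻ Z : ℝ × ℝ, ENNReal.ofReal ((√(Z.1 ^ 2 + Z.2 ^ 2))⁻¹) *
        capProfile R ((Z.1 + ρ * Real.cos ω) ^ 2 + (Z.2 + ρ * Real.sin ω) ^ 2) := by
    rw [Measure.volume_eq_prod, ← lintegral_add_right_eq_self _ (ρ * Real.cos ω, ρ * Real.sin ω)]
    simp
  rw [hshift, lintegral_inv_sqrt_mul (fun Z => capProfile R ((Z.1 + ρ * Real.cos ω) ^ 2 +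
    (Z.2 + ρ * Real.sin ω) ^ 2)) (hm.comp (by fun_prop))]
  have hline : ∀ θ : ℝ, ∫⁻ r : ℝ, capProfile R ((r * Real.cos θ + ρ * Real.cos ω) ^ 2 +
      (r * Real.sin θ + ρ * Real.sin ω) ^ 2) =
      ∫⁻ u : ℝ, capProfile R ((ρ * Real.sin (θ - ω)) ^ 2 + u ^ 2) := by
    intro θ
    rw [← lintegral_add_right_eq_self (fun u => capProfile R ((ρ * Real.sin (θ - ω)) ^ 2 + u ^ 2))
      (ρ * Real.cos (θ - ω))]
    congr 1; ext r
    congr 1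
    rw [Real.sin_sub, Real.cos_sub]
    linear_combination (r ^ 2 - ρ ^ 2 * (Real.sin ω ^ 2 + Real.cos ω ^ 2)) *
      Real.sin_sq_add_cos_sq θ
  simp_rw [hline, lintegral_capProfile_chord]
  -- The chord through the point in direction `θ` lies in the open disc unless it is tangent.
  have hae : ∀ᵐ θ : ℝ ∂(volume.restrict (Set.Ioo 0 Real.pi)),
      (if (ρ * Real.sin (θ - ω)) ^ 2 < R ^ 2 then
        ENNReal.ofReal (Real.pi / (1 + (ρ * Real.sin (θ - ω)) ^ 2)) else 0) =
      ENNReal.ofReal Real.pi *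
        ENNReal.ofReal (1 / (1 ^ 2 + ρ ^ 2 * Real.sin (θ - ω) ^ 2)) := by
    have hnull : volume {θ : ℝ | Real.cos (θ - ω) = 0} = 0 := by
      have hsub : {θ : ℝ | Real.cos (θ - ω) = 0} ⊆
          Set.range fun k : ℤ => ω + (2 * k + 1) * Real.pi / 2 := by
        intro θ hθ
        obtain ⟨k, hk⟩ := Real.cos_eq_zero_iff.1 hθ
        exact ⟨k, by simp only; rw [← hk]; ring⟩
      exact ((Set.countable_range _).mono hsub).measure_zero _
    have hne : ∀ᵐ θ : ℝ, Real.cos (θ - ω) ≠ 0 := by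
      rw [ae_iff]; simpa using hnull
    filter_upwards [ae_restrict_of_ae hne] with θ hθ
    have hlt : (ρ * Real.sin (θ - ω)) ^ 2 < R ^ 2 := by
      have h1 := Real.sin_sq_add_cos_sq (θ - ω)
      have h2 : 0 < Real.cos (θ - ω) ^ 2 := by positivity
      rcases hρ.eq_or_lt with rfl | hρ0
      · simpa using pow_pos hR 2
      · rw [mul_pow]
        nlinarith [mul_pos (pow_pos hρ0 2) h2, pow_le_pow_left₀ hρ hρR 2]
    rw [if_pos hlt, ← ENNReal.ofReal_mul Real.pi_pos.le]
    congr 1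
    rw [mul_pow]
    ring
  rw [lintegral_congr_ae hae, lintegral_const_mul' _ _ ENNReal.ofReal_ne_top]
  have h := lintegral_div_add_sin_sq one_pos (sq_nonneg ρ) 0 ω 1
  rw [Nat.cast_one, one_mul, zero_add] at h
  rw [h, ← ENNReal.ofReal_mul Real.pi_pos.le, one_pow]
  congr 1
  ring

/-! ### Stereographic projection from the North Pole -/

/-- The inverse of the stereographic projection from the North Pole onto the equatorial plane. -/
noncomputable def invStereo (Y : ℝ × ℝ) : E3 :=
  !₂[2 * Y.1 / (1 + (Y.1 ^ 2 + Y.2 ^ 2)), 2 * Y.2 / (1 + (Y.1 ^ 2 + Y.2 ^ 2)),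
    (Y.1 ^ 2 + Y.2 ^ 2 - 1) / (1 + (Y.1 ^ 2 + Y.2 ^ 2))]

lemma continuous_invStereo : Continuous invStereo := by
  have h : ∀ Y : ℝ × ℝ, 1 + (Y.1 ^ 2 + Y.2 ^ 2) ≠ 0 := fun Y => by positivity
  unfold invStereo
  refine (PiLp.continuous_toLp 2 _).comp (continuous_pi fun i => ?_)
  fin_cases i <;> simp <;> fun_prop (disch := assumption)

lemma edist_invStereo_invStereo (X Y : ℝ × ℝ) :
    edist (invStereo X) (invStereo Y) = ENNReal.ofReal
      (2 * √((Y.1 - X.1) ^ 2 + (Y.2 - X.2) ^ 2) /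
        (√(1 + (X.1 ^ 2 + X.2 ^ 2)) * √(1 + (Y.1 ^ 2 + Y.2 ^ 2)))) := by
  have hX : 0 < 1 + (X.1 ^ 2 + X.2 ^ 2) := by positivity
  have hY : 0 < 1 + (Y.1 ^ 2 + Y.2 ^ 2) := by positivity
  rw [edist_dist, EuclideanSpace.dist_eq, Fin.sum_univ_three]
  congr 1
  have hsqrt : 2 * √((Y.1 - X.1) ^ 2 + (Y.2 - X.2) ^ 2) /
      (√(1 + (X.1 ^ 2 + X.2 ^ 2)) * √(1 + (Y.1 ^ 2 + Y.2 ^ 2))) =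
      √(2 ^ 2 * ((Y.1 - X.1) ^ 2 + (Y.2 - X.2) ^ 2) /
        ((1 + (X.1 ^ 2 + X.2 ^ 2)) * (1 + (Y.1 ^ 2 + Y.2 ^ 2)))) := by
    rw [Real.sqrt_div' _ (by positivity), Real.sqrt_mul hX.le, Real.sqrt_mul (by positivity),
      Real.sqrt_sq zero_le_two]
  rw [hsqrt]
  congr 1
  simp only [invStereo, Real.dist_eq, sq_abs, PiLp.toLp_apply,
    Matrix.cons_val_zero, Matrix.cons_val_one, Matrix.cons_val]
  field_simp
  ring

lemma edist_invStereo_axis (h : ℝ) (Y : ℝ × ℝ) :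
    edist (invStereo Y) (h • northPole) = ENNReal.ofReal
      (√((h + 1) ^ 2 + (h - 1) ^ 2 * (Y.1 ^ 2 + Y.2 ^ 2)) / √(1 + (Y.1 ^ 2 + Y.2 ^ 2))) := by
  have hY : 0 < 1 + (Y.1 ^ 2 + Y.2 ^ 2) := by positivity
  rw [edist_dist, EuclideanSpace.dist_eq, Fin.sum_univ_three, ← Real.sqrt_div' _ hY.le]
  congr 2
  simp only [invStereo, northPole, Real.dist_eq, sq_abs, PiLp.smul_apply, PiLp.toLp_apply,
    Matrix.cons_val_zero, Matrix.cons_val_one, Matrix.cons_val, smul_eq_mul]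
  field_simp
  ring

lemma invStereo_tan (ψ ω : ℝ) (hψ : Real.cos ψ ≠ 0) :
    invStereo (Real.tan ψ * Real.cos ω, Real.tan ψ * Real.sin ω) =
      spherePoint (Real.pi - 2 * ψ) ω := by
  have h1 : (Real.tan ψ * Real.cos ω) ^ 2 + (Real.tan ψ * Real.sin ω) ^ 2 = Real.tan ψ ^ 2 := by
    linear_combination Real.tan ψ ^ 2 * Real.sin_sq_add_cos_sq ω
  have h2 : 1 + Real.tan ψ ^ 2 = (Real.cos ψ ^ 2)⁻¹ := by
    rw [← Real.inv_one_add_tan_sq hψ, inv_inv]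
  rw [invStereo, spherePoint, Real.sin_pi_sub, Real.cos_pi_sub, Real.sin_two_mul,
    Real.cos_two_mul]
  simp only [h1, h2]
  rw [Real.tan_eq_sin_div_cos]
  have hs := Real.sin_sq_add_cos_sq ψ
  congr 1
  ext i
  fin_cases i <;> simp <;> field_simp
  linear_combination hs

/-! ### The equilibrium measure of the cap, up to normalisation -/

/-- The image on the sphere of the planar measure with density
`2 / √(1 + |Y|²) * capProfile R |Y|²`. For `R = cot (α / 2)` it is a multiple of the equilibrium
measure of the cap `C_{S,α}`. -/
noncomputable def capMeasure (R : ℝ) : Measure E3 :=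
  (volume.withDensity fun Y : ℝ × ℝ =>
    ENNReal.ofReal (2 / √(1 + (Y.1 ^ 2 + Y.2 ^ 2))) * capProfile R (Y.1 ^ 2 + Y.2 ^ 2)).map
    invStereo

lemma lintegral_capMeasure (R : ℝ) (f : E3 → ℝ≥0∞) (hf : Measurable f) :
    ∫⁻ x, f x ∂(capMeasure R) = ∫⁻ Y : ℝ × ℝ, ENNReal.ofReal (2 / √(1 + (Y.1 ^ 2 + Y.2 ^ 2))) *
      capProfile R (Y.1 ^ 2 + Y.2 ^ 2) * f (invStereo Y) := by
  have hm := measurable_capProfile R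
  have hS := continuous_invStereo.measurable
  rw [capMeasure, lintegral_map hf hS,
    lintegral_withDensity_eq_lintegral_mul _ (by fun_prop) (g := fun Y => f (invStereo Y))
      (hf.comp hS)]
  rfl

/-- The potential of `capMeasure R` is constant on the cap: the conformal factors of the
stereographic projection turn it into `√(1 + ρ²)` times the planar potential of the profile. -/
lemma newtonPotential_capMeasure {R ρ : ℝ} (hR : 0 < R) (hρ : 0 ≤ ρ) (hρR : ρ ≤ R) (ω : ℝ) :
    newtonPotential (capMeasure R) (invStereo (ρ * Real.cos ω, ρ * Real.sin ω)) =
      ENNReal.ofReal (Real.pi ^ 2) := by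
  have hρ2 : (ρ * Real.cos ω) ^ 2 + (ρ * Real.sin ω) ^ 2 = ρ ^ 2 := by
    linear_combination ρ ^ 2 * Real.sin_sq_add_cos_sq ω
  have hρpos : 0 < √(1 + ρ ^ 2) := Real.sqrt_pos.2 (by positivity)
  rw [newtonPotential, lintegral_capMeasure _ _ (by fun_prop)]
  have hae : ∀ᵐ Y : ℝ × ℝ, ENNReal.ofReal (2 / √(1 + (Y.1 ^ 2 + Y.2 ^ 2))) *
      capProfile R (Y.1 ^ 2 + Y.2 ^ 2) *
      (edist (invStereo (ρ * Real.cos ω, ρ * Real.sin ω)) (invStereo Y))⁻¹ =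
      ENNReal.ofReal (√(1 + ρ ^ 2)) * (ENNReal.ofReal
        ((√((Y.1 - ρ * Real.cos ω) ^ 2 + (Y.2 - ρ * Real.sin ω) ^ 2))⁻¹) *
          capProfile R (Y.1 ^ 2 + Y.2 ^ 2)) := by
    -- At the point itself the kernel is `∞` on the left, but `0⁻¹ = 0` on the right.
    have hne : ∀ᵐ Y : ℝ × ℝ, Y ≠ (ρ * Real.cos ω, ρ * Real.sin ω) := by
      rw [ae_iff]; simp
    filter_upwards [hne] with Y hY
    have hYpos : 0 < √(1 + (Y.1 ^ 2 + Y.2 ^ 2)) := Real.sqrt_pos.2 (by positivity)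
    have hd : 0 < √((Y.1 - ρ * Real.cos ω) ^ 2 + (Y.2 - ρ * Real.sin ω) ^ 2) := by
      refine Real.sqrt_pos.2 ((add_nonneg (sq_nonneg _) (sq_nonneg _)).lt_of_ne' fun h => hY ?_)
      have h1 := sq_nonneg (Y.1 - ρ * Real.cos ω)
      have h2 := sq_nonneg (Y.2 - ρ * Real.sin ω)
      ext
      · exact sub_eq_zero.1 (pow_eq_zero_iff two_ne_zero |>.1 (by linarith))
      · exact sub_eq_zero.1 (pow_eq_zero_iff two_ne_zero |>.1 (by linarith))
    rw [edist_invStereo_invStereo, ← ENNReal.ofReal_inv_of_pos (by rw [hρ2]; positivity),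
      mul_right_comm, ← mul_assoc, ← ENNReal.ofReal_mul (by positivity),
      ← ENNReal.ofReal_mul (by positivity), hρ2]
    congr 2
    field_simp
  rw [lintegral_congr_ae hae, lintegral_const_mul' _ _ ENNReal.ofReal_ne_top,
    lintegral_inv_sqrt_mul_capProfile hR hρ hρR, ← ENNReal.ofReal_mul (by positivity)]
  congr 1
  field_simp

lemma lintegral_pointChargeField_capMeasure {R q h : ℝ} (hR : 0 < R) (hq : 0 < q) (hh : 0 < h) :
    ∫⁻ x, pointChargeField q h x ∂(capMeasure R) = ENNReal.ofReal
      (Real.pi * q / h * ((h + 1) * Real.arctan R -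
        (h - 1) * Real.arctan (R * ((h - 1) / (h + 1))))) := by
  have hpt : ∀ Y : ℝ × ℝ, ENNReal.ofReal (2 / √(1 + (Y.1 ^ 2 + Y.2 ^ 2))) *
      capProfile R (Y.1 ^ 2 + Y.2 ^ 2) * pointChargeField q h (invStereo Y) =
      ENNReal.ofReal (2 * q) * (capProfile R (Y.1 ^ 2 + Y.2 ^ 2) *
        ENNReal.ofReal ((√((h + 1) ^ 2 + (h - 1) ^ 2 * (Y.1 ^ 2 + Y.2 ^ 2)))⁻¹)) := by
    intro Y
    have hYpos : 0 < √(1 + (Y.1 ^ 2 + Y.2 ^ 2)) := Real.sqrt_pos.2 (by positivity)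
    have hd : 0 < √((h + 1) ^ 2 + (h - 1) ^ 2 * (Y.1 ^ 2 + Y.2 ^ 2)) :=
      Real.sqrt_pos.2 (by positivity)
    rw [pointChargeField, edist_invStereo_axis, ← ENNReal.ofReal_div_of_pos (by positivity),
      mul_right_comm, mul_left_comm, ← ENNReal.ofReal_mul (by positivity),
      ← ENNReal.ofReal_mul (by positivity), mul_comm]
    congr 2
    field_simp
  have hmeas : Measurable (pointChargeField q h) := by
    unfold pointChargeField; fun_prop
  rw [lintegral_capMeasure _ _ hmeas]
  simp_rw [hpt]
  rw [lintegral_const_mul' _ _ ENNReal.ofReal_ne_top,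
    lintegral_capProfile_mul_inv_sqrt hR (by positivity) (sq_nonneg _)]
  have h1 : 0 < h + 1 := by positivity
  have hder : ∀ s : ℝ, HasDerivAt (fun s => Real.pi / (4 * h) * ((h + 1) * Real.arctan s -
      (h - 1) * Real.arctan (s * ((h - 1) / (h + 1)))))
      (Real.pi / (1 + s ^ 2) * ((h + 1) / ((h + 1) ^ 2 + (h - 1) ^ 2 * s ^ 2))) s := by
    intro s
    have ha := (Real.hasDerivAt_arctan s).const_mul (h + 1)
    have hb := (((hasDerivAt_id s).mul_const ((h - 1) / (h + 1))).arctan).const_mul (h - 1)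
    convert! (ha.sub hb).const_mul (Real.pi / (4 * h)) using 1
    have h2 : 0 < 1 + s ^ 2 := by positivity
    have h3 : 0 < (h + 1) ^ 2 + (h - 1) ^ 2 * s ^ 2 := by positivity
    have h4 : 1 + (id s * ((h - 1) / (h + 1))) ^ 2 =
        ((h + 1) ^ 2 + (h - 1) ^ 2 * s ^ 2) / (h + 1) ^ 2 := by
      simp only [id]; field_simp
    rw [h4]
    field_simp
    ring
  rw [lintegral_Ioo_of_hasDerivAt (by linarith)
    (fun s _ => (hder s).continuousAt.continuousWithinAt) (fun s _ => hder s)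
    (fun s _ => by positivity), ← ENNReal.ofReal_mul (by positivity), neg_mul, Real.arctan_neg,
    Real.arctan_neg]
  congr 1
  field_simp
  ring

lemma capMeasure_univ {R : ℝ} (hR : 0 < R) :
    capMeasure R Set.univ =
      ENNReal.ofReal (2 * Real.pi * (Real.arctan R + R / (1 + R ^ 2))) := by
  have hpt : ∀ Y : ℝ × ℝ, ENNReal.ofReal (2 / √(1 + (Y.1 ^ 2 + Y.2 ^ 2))) *
      capProfile R (Y.1 ^ 2 + Y.2 ^ 2) * 1 =
      ENNReal.ofReal 2 * (capProfile R (Y.1 ^ 2 + Y.2 ^ 2) *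
        ENNReal.ofReal ((√(1 ^ 2 + 1 * (Y.1 ^ 2 + Y.2 ^ 2)))⁻¹)) := by
    intro Y
    rw [mul_one, div_eq_mul_inv, ENNReal.ofReal_mul zero_le_two, one_pow, one_mul]
    ring
  rw [← lintegral_one, lintegral_capMeasure _ _ measurable_const]
  simp_rw [hpt]
  rw [lintegral_const_mul' _ _ ENNReal.ofReal_ne_top,
    lintegral_capProfile_mul_inv_sqrt hR one_pos zero_le_one]
  have hder : ∀ s : ℝ, HasDerivAt (fun s => Real.pi / 2 * (Real.arctan s + s / (1 + s ^ 2)))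
      (Real.pi / (1 + s ^ 2) * (1 / (1 ^ 2 + 1 * s ^ 2))) s := by
    intro s
    have h2 : 1 + s ^ 2 ≠ 0 := by positivity
    have h := ((Real.hasDerivAt_arctan s).add ((hasDerivAt_id s).div
      (((hasDerivAt_id s).pow 2).const_add 1) h2)).const_mul (Real.pi / 2)
    convert! h using 1
    simp only [id, Pi.pow_apply]
    field_simp
    ring
  rw [lintegral_Ioo_of_hasDerivAt (by linarith)
    (fun s _ => (hder s).continuousAt.continuousWithinAt) (fun s _ => hder s)
    (fun s _ => by positivity), ← ENNReal.ofReal_mul (by positivity), Real.arctan_neg]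
  congr 1
  field_simp
  ring

/-! ### The cap in stereographic coordinates -/

lemma exists_invStereo_eq_of_mem_southCap {α : ℝ} (hα : 0 < α) {x : E3} (hx : x ∈ southCap α) :
    ∃ ρ ω : ℝ, 0 ≤ ρ ∧ ρ ≤ Real.tan ((Real.pi - α) / 2) ∧
      x = invStereo (ρ * Real.cos ω, ρ * Real.sin ω) := by
  obtain ⟨φ, ⟨hφ1, hφ2⟩, ω, -, rfl⟩ := hx
  refine ⟨Real.tan ((Real.pi - φ) / 2), ω, ?_, ?_, ?_⟩
  · exact Real.tan_nonneg_of_nonneg_of_le_pi_div_two (by linarith) (by linarith)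
  · exact Real.strictMonoOn_tan.monotoneOn ⟨by linarith [Real.pi_pos], by linarith⟩
      ⟨by linarith [Real.pi_pos], by linarith⟩ (by linarith)
  · rw [invStereo_tan _ _ (Real.cos_pos_of_mem_Ioo
      ⟨by linarith [Real.pi_pos], by linarith⟩).ne']
    congr 1
    ring

lemma invStereo_mem_southCap {α : ℝ} (hα : 0 < α) (hαπ : α < Real.pi) {Y : ℝ × ℝ}
    (hY : Y.1 ^ 2 + Y.2 ^ 2 ≤ Real.tan ((Real.pi - α) / 2) ^ 2) : invStereo Y ∈ southCap α := by
  obtain ⟨θ, hθ, h1, h2⟩ : ∃ θ ∈ Set.Icc 0 (2 * Real.pi),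
      √(Y.1 ^ 2 + Y.2 ^ 2) * Real.cos θ = Y.1 ∧ √(Y.1 ^ 2 + Y.2 ^ 2) * Real.sin θ = Y.2 := by
    have hn : ‖(⟨Y.1, Y.2⟩ : ℂ)‖ = √(Y.1 ^ 2 + Y.2 ^ 2) := by
      rw [Complex.norm_eq_sqrt_sq_add_sq]
    have hc := Complex.norm_mul_cos_arg ⟨Y.1, Y.2⟩
    have hs := Complex.norm_mul_sin_arg ⟨Y.1, Y.2⟩
    rw [hn] at hc hs
    have hlo := Complex.neg_pi_lt_arg ⟨Y.1, Y.2⟩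
    have hhi := Complex.arg_le_pi ⟨Y.1, Y.2⟩
    rcases le_or_gt 0 (Complex.arg ⟨Y.1, Y.2⟩) with h | h
    · exact ⟨_, ⟨h, by linarith [Real.pi_pos]⟩, hc, hs⟩
    · refine ⟨Complex.arg ⟨Y.1, Y.2⟩ + 2 * Real.pi, ⟨by linarith, by linarith⟩, ?_, ?_⟩
      · rwa [Real.cos_add_two_pi]
      · rwa [Real.sin_add_two_pi]
  set r := √(Y.1 ^ 2 + Y.2 ^ 2) with hr
  have hr0 : 0 ≤ r := Real.sqrt_nonneg _
  have ht0 : 0 ≤ Real.tan ((Real.pi - α) / 2) :=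
    Real.tan_nonneg_of_nonneg_of_le_pi_div_two (by linarith) (by linarith)
  have hle : Real.arctan r ≤ (Real.pi - α) / 2 := by
    rw [← Real.arctan_tan (x := (Real.pi - α) / 2) (by linarith) (by linarith)]
    exact Real.arctan_mono (Real.sqrt_le_iff.2 ⟨ht0, hY⟩)
  refine ⟨Real.pi - 2 * Real.arctan r, ⟨by linarith, ?_⟩, θ, hθ, ?_⟩
  · linarith [Real.arctan_nonneg.2 hr0]
  · rw [← invStereo_tan _ _ (Real.cos_arctan_pos r).ne', Real.tan_arctan, h1, h2]

lemma isCompact_southCap (α : ℝ) : IsCompact (southCap α) := by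
  have h : southCap α = (fun p : ℝ × ℝ => spherePoint p.1 p.2) ''
      (Set.Icc α Real.pi ×ˢ Set.Icc 0 (2 * Real.pi)) := by
    ext x
    constructor
    · rintro ⟨φ, hφ, θ, hθ, rfl⟩
      exact ⟨(φ, θ), ⟨hφ, hθ⟩, rfl⟩
    · rintro ⟨⟨φ, θ⟩, ⟨hφ, hθ⟩, rfl⟩
      exact ⟨φ, hφ, θ, hθ, rfl⟩
  rw [h]
  refine (isCompact_Icc.prod isCompact_Icc).image ?_
  unfold spherePoint
  refine (PiLp.continuous_toLp 2 _).comp (continuous_pi fun i => ?_)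
  fin_cases i <;> simp <;> fun_prop

lemma capMeasure_compl_southCap {α : ℝ} (hα : 0 < α) (hαπ : α < Real.pi) :
    capMeasure (Real.tan ((Real.pi - α) / 2)) (southCap α)ᶜ = 0 := by
  have hmS : MeasurableSet (southCap α)ᶜ := (isCompact_southCap α).isClosed.measurableSet.compl
  rw [← lintegral_indicator_one hmS, lintegral_capMeasure _ _ (measurable_one.indicator hmS)]
  refine lintegral_eq_zero_of_ae_eq_zero (ae_of_all _ fun Y => ?_)
  rcases le_or_gt (Real.tan ((Real.pi - α) / 2) ^ 2) (Y.1 ^ 2 + Y.2 ^ 2) with h | h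
  · simp [capProfile_eq_zero h]
  · simp [invStereo_mem_southCap hα hαπ h.le]

/-! ### Measures with constant potential -/

/-- A unit measure on `E` whose potential is constant on `E` is the only equilibrium measure
of `E`, and the constant is the energy of `E`. -/
lemma isEquilibriumMeasure_iff_of_newtonPotential_eq {E : Set E3} {μ : Measure E3} {w : ℝ≥0∞}
    (hw : w ≠ ∞) (hμ : μ ∈ unitMeasuresOn E) (hU : ∀ x ∈ E, newtonPotential μ x = w) :
    minEnergy E = w ∧ ∀ ν, IsEquilibriumMeasure E ν ↔ ν = μ := by
  have hprob := hμ.1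
  have hint : ∀ ν ∈ unitMeasuresOn E, ∫⁻ x, newtonPotential μ x ∂ν = w := by
    intro ν hν
    have := hν.1
    have hE : ∀ᵐ x ∂ν, x ∈ E := hν.2
    rw [lintegral_congr_ae (hE.mono hU), lintegral_const, measure_univ, mul_one]
  have hμw : newtonEnergy μ = w := hint μ hμ
  have hlow : ∀ ν ∈ unitMeasuresOn E, w ≤ newtonEnergy ν := by
    intro ν hν
    have := hν.1
    have h := two_mul_lintegral_newtonPotential_le μ ν
    rw [hint ν hν, hμw, two_mul] at h
    exact (ENNReal.add_le_add_iff_left hw).1 h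
  have hmin : minEnergy E = w :=
    le_antisymm ((iInf₂_le μ hμ).trans hμw.le) (le_iInf₂ hlow)
  refine ⟨hmin, fun ν => ⟨fun hν => ?_, ?_⟩⟩
  · have := hν.1.1
    refine (eq_of_two_mul_lintegral_newtonPotential_eq ?_ ?_).symm
    · rwa [hint ν hν.1]
    · rw [hint ν hν.1, hμw, hν.2, hmin, two_mul]
  · rintro rfl
    exact ⟨hμ, hμw.trans hmin.symm⟩

/-! ### The functional of a point charge -/

theorem mainTheorem10 (q h α : ℝ) (hq : 0 < q) (hh : 0 < h) (hα : 0 < α) (hαπ : α < Real.pi) :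
    0 < newtonCapacity (southCap α) ∧
    (∃! μ : Measure E3, IsEquilibriumMeasure (southCap α) μ) ∧
    fFunctional (pointChargeField q h) (southCap α) ≠ ∞ ∧
    (fFunctional (pointChargeField q h) (southCap α)).toReal =
      Real.pi / (Real.pi - α + Real.sin α) *
        (1 + q * (h + 1) / (2 * h) * (1 - α / Real.pi)
          - q * (h - 1) / (Real.pi * h) *
            Real.arctan (Real.cot (α / 2) * ((h - 1) / (h + 1)))) := by
  have hπ := Real.pi_pos
  have hsin : 0 < Real.sin α := Real.sin_pos_of_pos_of_lt_pi hα hαπ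
  -- Stereographic projection takes polar angle `φ` to radius `tan ((π - φ) / 2)`, so `R` is the
  -- radius of the disc and `ψ = arctan R`.
  set ψ := (Real.pi - α) / 2 with hψ
  set R := Real.tan ψ with hRdef
  have hR : 0 < R := Real.tan_pos_of_pos_of_lt_pi_div_two (by linarith) (by linarith)
  have hψR : Real.arctan R = ψ := Real.arctan_tan (by linarith) (by linarith)
  have hcot : Real.cot (α / 2) = R := by
    rw [hRdef, hψ, sub_div, Real.tan_pi_div_two_sub, Real.cot_eq_cos_div_sin,
      Real.tan_eq_sin_div_cos, inv_div]
  have hRsin : R / (1 + R ^ 2) = Real.sin α / 2 := by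
    have hc : Real.cos ψ ≠ 0 :=
      (Real.cos_pos_of_mem_Ioo ⟨by linarith, by linarith⟩).ne'
    have h2 : Real.sin α = 2 * Real.sin ψ * Real.cos ψ := by
      rw [← Real.sin_two_mul, ← Real.sin_pi_sub]; congr 1; rw [hψ]; ring
    rw [div_eq_mul_inv, hRdef, Real.inv_one_add_tan_sq hc, h2, Real.tan_eq_sin_div_cos]
    field_simp
  set m := Real.pi * (Real.pi - α + Real.sin α) with hm
  have hm0 : 0 < m := mul_pos hπ (by linarith)
  have hmass : capMeasure R Set.univ = ENNReal.ofReal m := by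
    rw [capMeasure_univ hR, hψR, hRsin]
    congr 1; rw [hm, hψ]; ring
  set μ : Measure E3 := ENNReal.ofReal m⁻¹ • capMeasure R with hμdef
  have hμ : μ ∈ unitMeasuresOn (southCap α) := by
    refine ⟨⟨?_⟩, ?_⟩
    · rw [hμdef, Measure.smul_apply, hmass, smul_eq_mul, ← ENNReal.ofReal_mul (by positivity),
        inv_mul_cancel₀ hm0.ne', ENNReal.ofReal_one]
    · rw [hμdef, Measure.smul_apply, capMeasure_compl_southCap hα hαπ, smul_zero]
  have hU : ∀ x ∈ southCap α, newtonPotential μ x = ENNReal.ofReal (m⁻¹ * Real.pi ^ 2) := by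
    intro x hx
    obtain ⟨ρ, ω, hρ, hρR, rfl⟩ := exists_invStereo_eq_of_mem_southCap hα hx
    rw [newtonPotential, hμdef, lintegral_smul_measure, ← newtonPotential,
      newtonPotential_capMeasure hR hρ hρR, smul_eq_mul, ← ENNReal.ofReal_mul (by positivity)]
  obtain ⟨hmin, hiff⟩ := isEquilibriumMeasure_iff_of_newtonPotential_eq ENNReal.ofReal_ne_top hμ hU
  have hex : ∃ ν, IsEquilibriumMeasure (southCap α) ν := ⟨μ, (hiff μ).2 rfl⟩
  have heq : equilibriumMeasure (southCap α) = μ := by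
    rw [equilibriumMeasure, dif_pos hex]
    exact (hiff _).1 hex.choose_spec
  -- `ENNReal.ofReal` truncates at `0`, so the sign of the field integral is needed to add it to the
  -- energy.
  have hatan : 0 ≤ (h + 1) * ψ - (h - 1) * Real.arctan (R * ((h - 1) / (h + 1))) := by
    have h1 : 0 < h + 1 := by positivity
    have habs : |Real.arctan (R * ((h - 1) / (h + 1)))| ≤ ψ := by
      rw [← hψR, abs_le, ← Real.arctan_neg]
      refine ⟨Real.arctan_mono ?_, Real.arctan_mono ?_⟩
      · have : -1 ≤ (h - 1) / (h + 1) := by rw [le_div_iff₀ h1]; linarith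
        nlinarith
      · have : (h - 1) / (h + 1) ≤ 1 := by rw [div_le_one h1]; linarith
        nlinarith
    have h2 : |h - 1| ≤ h + 1 := by rw [abs_le]; constructor <;> linarith
    have h3 := mul_le_mul h2 habs (abs_nonneg _) h1.le
    rw [← abs_mul] at h3
    linarith [le_abs_self ((h - 1) * Real.arctan (R * ((h - 1) / (h + 1))))]
  have hF : fFunctional (pointChargeField q h) (southCap α) = ENNReal.ofReal
      (m⁻¹ * Real.pi ^ 2 + m⁻¹ * (Real.pi * q / h *
        ((h + 1) * ψ - (h - 1) * Real.arctan (R * ((h - 1) / (h + 1)))))) := by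
    rw [fFunctional, hmin, heq, hμdef, lintegral_smul_measure,
      lintegral_pointChargeField_capMeasure hR hq hh, hψR, smul_eq_mul,
      ← ENNReal.ofReal_mul (by positivity), ← ENNReal.ofReal_add (by positivity) (by positivity)]
  refine ⟨?_, ⟨μ, (hiff μ).2 rfl, fun ν hν => (hiff ν).1 hν⟩, ?_, ?_⟩
  · rw [newtonCapacity, hmin]
    exact ENNReal.inv_pos.2 ENNReal.ofReal_ne_top
  · rw [hF]; exact ENNReal.ofReal_ne_top
  · rw [hF, ENNReal.toReal_ofReal (by positivity), hcot, hm, hψ]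
    have h3 : 0 < Real.pi - α + Real.sin α := by linarith
    field_simp
    ring
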